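/- Consider $N$ identical single-input discrete-time agents $x_i(t+1)=Ax_i(t)+Bu_i(t)$ with $A\in\mathbb{R}^{n\times n}$, $B\in\mathbb{R}^{n\times 1}$, communicating over a directed graph on $\{1,\dots,N\}$ without self-loops, with weights $a_{ij}\ge 0$, $a_{ii}=0$ ($a_{ij}>0$ if and only if there is an edge from $j$ to $i$). Let $\mathcal{L}=\mathrm{diag}\big(\sum_j a_{1j},\dots,\sum_j a_{Nj}\big)-[a_{ij}]$ be its Laplacian, with eigenvalues, counted with algebraic multiplicity and ordered by increasing real part, $\lambda_1(\mathcal{L})=0,\lambda_2(\mathcal{L}),\dots,\lambda_N(\mathcal{L})\in\mathbb{C}$. Let $\lambda^u_j(A)$ be the unstable eigenvalues of $A$, that is, those of modulus at least $1$, counted with algebraic multiplicity, and define $\prod_j|\lambda^u_j(A)|$ to be $0$ if there are none. Suppose that $(A,B)$ is stabilizable, that is, $A+BK_0$ has all its eigenvalues in the open unit disk for some $K_0\in\mathbb{R}^{1\times n}$, and that $$\prod_j|\lambda_j^u(A)|<\frac{1}{\inf_{\omega\in\mathbb{R}}\max_{j\in\{2,\dots,N\}}|1-\omega\lambda_j(\mathcal{L})|},$$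 where the right-hand side is $+\infty$ if the infimum is $0$ (and, if $N=1$, the maximum over the empty set is $0$). Then there exists $K\in\mathbb{R}^{1\times n}$ such that for every $i=2,\dots,N$ all eigenvalues of $A-\lambda_i(\mathcal{L})BK$ lie in the open unit disk of the complex plane. -/

import Mathlib

open scoped ENNReal

noncomputable section

namespace MultiAgent

/-- A finite weighted directed graph on the nodes `0, …, N-1` without self-loops, given by its
weighted adjacency matrix: there is an edge from `j` to `i` exactly when `0 < weight i j`. -/
structure WeightedDigraph (N : ℕ) where
  weight : Matrix (Fin N) (Fin N) ℝ
  weight_nonneg : ∀ i j, 0 ≤ weight i j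
  weight_self : ∀ i, weight i i = 0

/-- The Laplacian `D - 𝒜`, where `D` is the diagonal matrix of the in-degrees `∑ j, a i j`. -/
def WeightedDigraph.laplacian {N : ℕ} (G : WeightedDigraph N) : Matrix (Fin N) (Fin N) ℝ :=
  Matrix.diagonal (fun i => ∑ j, G.weight i j) - G.weight

/-- A real matrix regarded as a complex matrix. -/
def toComplex {k l : ℕ} (M : Matrix (Fin k) (Fin l) ℝ) : Matrix (Fin k) (Fin l) ℂ :=
  M.map Complex.ofReal

/-- The complex eigenvalues of a real square matrix, with algebraic multiplicity. -/
def eigenvalues {k : ℕ} (M : Matrix (Fin k) (Fin k) ℝ) : Multiset ℂ :=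
  (toComplex M).charpoly.roots

/-- The eigenvalues `λ₂, …, λ_N` of the Laplacian, with algebraic multiplicity: all its
eigenvalues except one copy of `λ₁ = 0`. (Zero is an eigenvalue as soon as `N ≥ 1`, see
`zero_mem_eigenvalues_laplacian`; all the others have nonnegative real part.) -/
def WeightedDigraph.tailEigenvalues {N : ℕ} (G : WeightedDigraph N) : Multiset ℂ :=
  (eigenvalues G.laplacian).erase 0

theorem zero_mem_eigenvalues_laplacian {N : ℕ} (hN : 1 ≤ N) (G : WeightedDigraph N) :
    (0 : ℂ) ∈ eigenvalues G.laplacian := by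
  have hne : Nonempty (Fin N) := ⟨⟨0, hN⟩⟩
  rw [eigenvalues, Polynomial.mem_roots (Matrix.charpoly_monic _).ne_zero,
    ← Matrix.mem_spectrum_iff_isRoot_charpoly, spectrum.zero_mem_iff,
    Matrix.isUnit_iff_isUnit_det, isUnit_iff_ne_zero, not_not]
  refine Matrix.exists_mulVec_eq_zero_iff.mp ⟨fun _ => 1, ?_, ?_⟩
  · intro h
    exact one_ne_zero (congrFun h ⟨0, hN⟩)
  · funext i
    simp [toComplex, WeightedDigraph.laplacian, Matrix.mulVec, dotProduct, Matrix.diagonal_apply,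
      Finset.sum_sub_distrib, apply_ite Complex.ofReal]

/-- All eigenvalues lie in the open unit disk. -/
def IsSchurStable {k : ℕ} (M : Matrix (Fin k) (Fin k) ℂ) : Prop :=
  ∀ z ∈ spectrum ℂ M, ‖z‖ < 1

/-- Stabilizability of the discrete-time pair `(A, B)` by a real state feedback. -/
def IsStabilizable {n m : ℕ} (A : Matrix (Fin n) (Fin n) ℝ) (B : Matrix (Fin n) (Fin m) ℝ) :
    Prop :=
  ∃ K : Matrix (Fin m) (Fin n) ℝ, IsSchurStable (toComplex (A + B * K))

/-- The unstable eigenvalues of `A` (on or outside the unit circle), with algebraic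
multiplicity. -/
def unstableEigenvalues {n : ℕ} (A : Matrix (Fin n) (Fin n) ℝ) : Multiset ℂ :=
  (eigenvalues A).filter (fun z => 1 ≤ ‖z‖)

/-- The product of the moduli of the unstable eigenvalues of `A`; by convention it is `0` (not
the empty product) if there are none. -/
def unstableProduct {n : ℕ} (A : Matrix (Fin n) (Fin n) ℝ) : ℝ≥0∞ :=
  if unstableEigenvalues A = 0 then 0 else ((unstableEigenvalues A).map (fun z => ‖z‖ₑ)).prod

/-- `inf_{ω ∈ ℝ} max_{j ≥ 2} |1 - ω λ_j(L)|`, as an extended nonnegative real. -/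
def WeightedDigraph.infMax {N : ℕ} (G : WeightedDigraph N) : ℝ≥0∞ :=
  ⨅ ω : ℝ, ⨆ μ ∈ G.tailEigenvalues, ‖1 - (ω : ℂ) * μ‖ₑ

/-- A single real gain `K` makes `A - λ_i(L) B K` stable for all `i = 2, …, N`. -/
def SimultaneouslyStabilizable {n m N : ℕ} (A : Matrix (Fin n) (Fin n) ℝ)
    (B : Matrix (Fin n) (Fin m) ℝ) (G : WeightedDigraph N) : Prop :=
  ∃ K : Matrix (Fin m) (Fin n) ℝ, ∀ μ ∈ G.tailEigenvalues,
    IsSchurStable (toComplex A - μ • toComplex (B * K))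

end MultiAgent

end

/-! Choose `ω` with all `|1 - ωλ_j| ≤ r`, where `r` times the product of the unstable moduli is
below 1. It then suffices to find one gain `K` stabilizing `A - cBK` for every complex `c = 1 + d`
with `|d| ≤ r`; the answer is `ωK`.

With one input, `χ(A - cBK) = χ_A + c·φ`, where `φ = K adj(X - A) B` is linear in `K`. Write `χ_A =
s a` with the roots of `a` being the unstable eigenvalues. Stabilizability makes every `φ = s q`
with `deg q < deg a` available (`exists_feedbackPoly_eq`), so only `a + (1 + d) q` has to be kept
free of zeros in `|z| ≥ 1`.

Let `m = a(0)`, whose modulus is the unstable product, and let `a*` be the reverse of `a`. For `q =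
-m (a* - m a) / (1 - m²)` a zero means `a (1 + d m²) = a* m (1 + d)`. This is impossible: `|a| ≤
|a*|` and `a* ≠ 0` in `|z| ≥ 1`, while `|1 + d m²| < |m (1 + d)|` when `|d m| < 1`. Roots on the
unit circle are first pushed outside by a slight scaling. -/

/-! ### Rank-one feedback and the characteristic polynomial. -/

namespace Matrix

open Polynomial

variable {ι R F : Type*} [Fintype ι] [DecidableEq ι]

/-- The matrix determinant lemma in adjugate form. -/
theorem det_add_vecMulVec [CommRing R] [IsDomain R] (M : Matrix ι ι R) (hM : M.det ≠ 0)
    (u v : ι → R) : (M + vecMulVec u v).det = M.det + v ⬝ᵥ (M.adjugate *ᵥ u) := by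
  -- Over the fraction field `M` is invertible, so the usual determinant lemma applies.
  have hinj := IsFractionRing.injective R (FractionRing R)
  set f := algebraMap R (FractionRing R)
  apply hinj
  have hunit : IsUnit (M.map f).det := by
    rw [← RingHom.mapMatrix_apply, ← RingHom.map_det, isUnit_iff_ne_zero]
    exact fun h => hM (hinj (h.trans (map_zero f).symm))
  have key := det_add_replicateCol_mul_replicateRow (ι := Unit) hunit (f ∘ u) (f ∘ v)
  have h1 : f (M + vecMulVec u v).det
      = (M.map f + replicateCol Unit (f ∘ u) * replicateRow Unit (f ∘ v)).det := by
    rw [RingHom.map_det]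
    congr 1
    ext i j
    simp [vecMulVec_apply, mul_apply]
  have h2 : f (v ⬝ᵥ (M.adjugate *ᵥ u)) = (f ∘ v) ⬝ᵥ ((M.map f).adjugate *ᵥ (f ∘ u)) := by
    rw [RingHom.map_dotProduct, ← RingHom.mapMatrix_apply, ← RingHom.map_adjugate]
    congr 1
    ext i
    simp [RingHom.map_mulVec]
  have h3 : (replicateRow Unit (f ∘ v) * (Ring.inverse (M.map f).det • (M.map f).adjugate) *
      replicateCol Unit (f ∘ u)) default default
      = Ring.inverse (M.map f).det * ((f ∘ v) ⬝ᵥ ((M.map f).adjugate *ᵥ (f ∘ u))) := by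
    rw [Matrix.mul_smul, Matrix.smul_mul, smul_apply, smul_eq_mul, Matrix.mul_assoc]
    congr 1
  rw [h1, key, map_add, h2, RingHom.map_det, RingHom.mapMatrix_apply, det_unique (n := Unit),
    add_apply, one_apply_eq, inv_def, h3, mul_add, mul_one, ← mul_assoc,
    Ring.mul_inverse_cancel _ hunit, one_mul]

/-- The polynomial vector `adj (X - A) b`. -/
noncomputable def adjVec [CommRing R] (A : Matrix ι ι R) (b : ι → R) : ι → R[X] :=
  A.charmatrix.adjugate *ᵥ fun i => C (b i)

/-- The polynomial `k adj (X - A) b`. -/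
noncomputable def feedbackPoly [CommRing R] (A : Matrix ι ι R) (b k : ι → R) : R[X] :=
  ∑ i, C (k i) * adjVec A b i

theorem charpoly_sub_vecMulVec [CommRing R] [IsDomain R] (A : Matrix ι ι R) (b k : ι → R) :
    (A - vecMulVec b k).charpoly = A.charpoly + feedbackPoly A b k := by
  have h : (A - vecMulVec b k).charmatrix
      = A.charmatrix + vecMulVec (fun i => C (b i)) (fun i => C (k i)) := by
    ext1 i j
    simp only [charmatrix_apply, sub_apply, add_apply, vecMulVec_apply, map_sub, map_mul]
    ring
  rw [charpoly, h, det_add_vecMulVec _ A.charpoly_monic.ne_zero]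
  rfl

theorem feedbackPoly_map {S : Type*} [CommRing R] [CommRing S] (f : R →+* S) (A : Matrix ι ι R)
    (b k : ι → R) : (feedbackPoly A b k).map f = feedbackPoly (A.map f) (f ∘ b) (f ∘ k) := by
  have h : ∀ i, (adjVec A b i).map f = adjVec (A.map f) (f ∘ b) i := by
    intro i
    rw [adjVec, adjVec, charmatrix_map, ← coe_mapRingHom, ← RingHom.mapMatrix_apply,
      ← RingHom.map_adjugate, RingHom.map_mulVec]
    congr 1
    ext j
    simp
  simp [feedbackPoly, Polynomial.map_sum, h]

theorem feedbackPoly_add [CommRing R] (A : Matrix ι ι R) (b k l : ι → R) :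
    feedbackPoly A b (k + l) = feedbackPoly A b k + feedbackPoly A b l := by
  simp [feedbackPoly, add_mul, Finset.sum_add_distrib]

theorem feedbackPoly_smul [CommRing R] (A : Matrix ι ι R) (b k : ι → R) (c : R) :
    feedbackPoly A b (c • k) = C c * feedbackPoly A b k := by
  simp [feedbackPoly, Finset.mul_sum, mul_assoc]

/-- From `(X - A) adj(X - A) = χ_A`. Modulo `χ_A`, multiplication by `X` acts on the gain as `k ↦
kA`, which makes `feedbackIdeal` an ideal. -/
theorem X_mul_feedbackPoly [CommRing R] (A : Matrix ι ι R) (b k : ι → R) :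
    X * feedbackPoly A b k = feedbackPoly A b (k ᵥ* A) + A.charpoly * C (k ⬝ᵥ b) := by
  have h : A.charmatrix *ᵥ adjVec A b = A.charpoly • fun i => C (b i) := by
    rw [adjVec, mulVec_mulVec, mul_adjugate, smul_mulVec, one_mulVec, charpoly]
  have h' : ∀ i, X * adjVec A b i = ∑ j, C (A i j) * adjVec A b j + A.charpoly * C (b i) := by
    intro i
    have := congrFun h i
    rw [charmatrix, sub_mulVec] at this
    simp only [Pi.sub_apply, Pi.smul_apply, smul_eq_mul, RingHom.mapMatrix_apply] at this
    rw [← this]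
    simp [mulVec, dotProduct, scalar_apply, diagonal_apply]
  simp only [feedbackPoly, Finset.mul_sum, vecMul, dotProduct, map_sum, map_mul, Finset.sum_mul]
  rw [Finset.sum_comm, ← Finset.sum_add_distrib]
  refine Finset.sum_congr rfl fun i _ => ?_
  rw [mul_left_comm, h', mul_add, Finset.mul_sum]
  congr 1
  · exact Finset.sum_congr rfl fun j _ => by ring
  · ring

theorem degree_feedbackPoly_lt [CommRing R] [IsDomain R] (A : Matrix ι ι R) (b k : ι → R) :
    (feedbackPoly A b k).degree < A.charpoly.degree := by
  have h : feedbackPoly A b k = (A - vecMulVec b k).charpoly - A.charpoly := by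
    rw [charpoly_sub_vecMulVec]; ring
  rw [h]
  have hd : (A - vecMulVec b k).charpoly.degree = A.charpoly.degree := by
    rw [charpoly_degree_eq_dim, charpoly_degree_eq_dim]
  exact (degree_sub_lt_left hd (charpoly_monic _).ne_zero
    ((charpoly_monic _).leadingCoeff.trans (charpoly_monic _).leadingCoeff.symm)).trans_eq hd

/-- The polynomials congruent to some `k adj (X - A) b` modulo the characteristic polynomial. -/
noncomputable def feedbackIdeal [CommRing R] (A : Matrix ι ι R) (b : ι → R) : Ideal R[X] where
  carrier := {p | ∃ k h, p = feedbackPoly A b k + A.charpoly * h}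
  zero_mem' := ⟨0, 0, by simp [feedbackPoly]⟩
  add_mem' := by
    rintro _ _ ⟨k, h, rfl⟩ ⟨l, g, rfl⟩
    exact ⟨k + l, h + g, by rw [feedbackPoly_add]; ring⟩
  smul_mem' := by
    have hX : ∀ p : R[X], (∃ k h, p = feedbackPoly A b k + A.charpoly * h) →
        ∃ k h, X * p = feedbackPoly A b k + A.charpoly * h := by
      rintro _ ⟨k, h, rfl⟩
      exact ⟨k ᵥ* A, C (k ⬝ᵥ b) + X * h, by rw [mul_add, X_mul_feedbackPoly]; ring⟩
    have hC : ∀ (c : R) (p : R[X]), (∃ k h, p = feedbackPoly A b k + A.charpoly * h) →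
        ∃ k h, C c * p = feedbackPoly A b k + A.charpoly * h := by
      rintro c _ ⟨k, h, rfl⟩
      exact ⟨c • k, C c * h, by rw [feedbackPoly_smul]; ring⟩
    intro c p hp
    rw [smul_eq_mul]
    induction c using Polynomial.induction_on generalizing p with
    | C a => exact hC a p hp
    | add f g hf hg =>
      obtain ⟨k, h, e⟩ := hf hp
      obtain ⟨l, g, e'⟩ := hg hp
      exact ⟨k + l, h + g, by rw [add_mul, e, e', feedbackPoly_add]; ring⟩
    | monomial m a ih =>
      have := ih (hX p hp)
      rwa [← mul_assoc, mul_assoc (C a), ← pow_succ] at this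

/-- A feedback can be chosen for every polynomial multiple of a factor `s` of the characteristic
polynomial whose cofactor becomes coprime to it under some feedback. -/
theorem exists_feedbackPoly_eq [Field F] (A : Matrix ι ι F) (b k₀ : ι → F) {s a q : F[X]}
    (hsa : A.charpoly = s * a) (hcop : IsCoprime a (A.charpoly + feedbackPoly A b k₀))
    (hq : q.degree < a.degree) : ∃ k, feedbackPoly A b k = s * q := by
  have hs : s ≠ 0 := by
    rintro rfl
    exact A.charpoly_monic.ne_zero (by rw [hsa, zero_mul])
  obtain ⟨x, y, hxy⟩ := hcop
  have h1 : A.charpoly ∈ feedbackIdeal A b := ⟨0, 1, by simp [feedbackPoly]⟩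
  have h2 : A.charpoly + feedbackPoly A b k₀ ∈ feedbackIdeal A b := ⟨k₀, 1, by ring⟩
  have h3 : s * q ∈ feedbackIdeal A b := by
    have e : s * q = (x * q) * A.charpoly
        + (y * s * q) * (A.charpoly + feedbackPoly A b k₀) := by
      calc s * q = s * q * (x * a + y * (A.charpoly + feedbackPoly A b k₀)) := by
            rw [hxy, mul_one]
        _ = (x * q) * (s * a) + (y * s * q) * (A.charpoly + feedbackPoly A b k₀) := by ring
        _ = _ := by rw [← hsa]
    rw [e]
    exact add_mem (Ideal.mul_mem_left _ _ h1) (Ideal.mul_mem_left _ _ h2)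
  obtain ⟨k, h, e⟩ := h3
  -- Both `s q` and the feedback polynomial have degree below that of `χ_A`, so their congruence
  -- modulo `χ_A` is an equality.
  have hdeg : (A.charpoly * h).degree < A.charpoly.degree := by
    have e' : A.charpoly * h = s * q - feedbackPoly A b k := by rw [e]; ring
    rw [e']
    refine (degree_sub_le _ _).trans_lt (max_lt ?_ (degree_feedbackPoly_lt A b k))
    rw [hsa, degree_mul, degree_mul]
    exact WithBot.add_lt_add_left (degree_ne_bot.mpr hs) hq
  have hh : h = 0 := by
    by_contra hh
    rw [degree_mul] at hdeg
    have : A.charpoly.degree ≤ A.charpoly.degree + h.degree :=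
      le_add_of_nonneg_right (zero_le_degree_iff.mpr hh)
    exact absurd hdeg this.not_gt
  exact ⟨k, by rw [e, hh]; ring⟩

end Matrix

/-! ### Real factors from conjugation-invariant sets of roots. -/

namespace Polynomial

open ComplexConjugate

/-- A monic real polynomial factors according to a conjugation-invariant property of its
complex roots. -/
theorem exists_real_factorization {p : ℝ[X]} (hp : p.Monic) (P : ℂ → Prop) [DecidablePred P]
    (hP : ∀ z, P (conj z) ↔ P z) :
    ∃ s a : ℝ[X], p = s * a ∧ s.Monic ∧ a.Monic ∧
      (s.map (algebraMap ℝ ℂ)).roots = (p.map (algebraMap ℝ ℂ)).roots.filter (fun z => ¬ P z) ∧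
      (a.map (algebraMap ℝ ℂ)).roots = (p.map (algebraMap ℝ ℂ)).roots.filter P := by
  set T := (p.map (algebraMap ℝ ℂ)).roots with hT
  have hTconj : T.map conj = T := by
    rw [hT, ← Splits.roots_map (IsAlgClosed.splits _) (starRingEnd ℂ), Polynomial.map_map]
    congr 2
    ext x
    simp
  have lift : ∀ (Q : ℂ → Prop) [DecidablePred Q], (∀ z, Q (conj z) ↔ Q z) →
      ∃ f : ℝ[X], f.map (algebraMap ℝ ℂ) = ((T.filter Q).map fun z => X - C z).prod ∧ f.Monic := by
    intro Q _ hQ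
    have hmon : ((T.filter Q).map fun z => X - C z).prod.Monic :=
      monic_multiset_prod_of_monic _ _ fun z _ => monic_X_sub_C z
    have hconj : (((T.filter Q).map fun z => X - C z).prod).map (starRingEnd ℂ)
        = ((T.filter Q).map fun z => X - C z).prod := by
      have hfilter : (T.filter Q).map conj = T.filter Q := by
        conv_rhs => rw [← hTconj]
        rw [Multiset.filter_map]
        congr 1
        exact Multiset.filter_congr fun z _ => (hQ z).symm
      conv_rhs => rw [← hfilter]
      rw [Polynomial.map_multiset_prod, Multiset.map_map, Multiset.map_map]
      simp
    have hlift : ((T.filter Q).map fun z => X - C z).prod ∈ lifts (algebraMap ℝ ℂ) := by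
      rw [lifts_iff_coeff_lifts]
      intro n
      have h := congrArg (fun g : ℂ[X] => g.coeff n) hconj
      simp only [coeff_map] at h
      obtain ⟨r, hr⟩ := Complex.conj_eq_iff_real.mp h
      exact ⟨r, hr.symm⟩
    obtain ⟨f, hf, -, hm⟩ := lifts_and_natDegree_eq_and_monic hlift hmon
    exact ⟨f, hf, hm⟩
  obtain ⟨a, ha, ham⟩ := lift P hP
  obtain ⟨s, hs, hsm⟩ := lift (fun z => ¬ P z) fun z => not_congr (hP z)
  refine ⟨s, a, ?_, hsm, ham, ?_, ?_⟩
  · apply map_injective _ (algebraMap ℝ ℂ).injective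
    rw [Polynomial.map_mul, ha, hs, ← Multiset.prod_add, ← Multiset.map_add, add_comm,
      Multiset.filter_add_not]
    exact Splits.eq_prod_roots_of_monic (IsAlgClosed.splits _) (hp.map _)
  · rw [hs, roots_multiset_prod_X_sub_C]
  · rw [ha, roots_multiset_prod_X_sub_C]

/-! ### A polynomial against its reverse outside the unit disk. -/

theorem aeval_eq_prod_roots {a : ℝ[X]} (ha : a.Monic) (z : ℂ) :
    aeval z a = ((a.map (algebraMap ℝ ℂ)).roots.map fun l => z - l).prod := by
  rw [aeval_def, ← eval_map]
  exact Splits.eval_eq_prod_roots_of_monic (IsAlgClosed.splits _) (ha.map _) z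

theorem abs_coeff_zero_eq_prod_norm_roots {a : ℝ[X]} (ha : a.Monic) :
    |a.coeff 0| = ((a.map (algebraMap ℝ ℂ)).roots.map fun l => ‖l‖).prod := by
  have h := aeval_eq_prod_roots ha 0
  rw [← coeff_zero_eq_aeval_zero'] at h
  have h' := congrArg (normHom : ℂ →*₀ ℝ) h
  rw [← Multiset.prod_hom, Multiset.map_map] at h'
  simpa using h'

theorem _root_.Multiset.norm_prod_map {ι : Type*} (s : Multiset ι) (f : ι → ℂ) :
    ‖(s.map f).prod‖ = (s.map fun i => ‖f i‖).prod := by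
  rw [← normHom_apply (_ : ℂ), ← Multiset.prod_hom, Multiset.map_map]
  rfl

/-- The Blaschke identity: the squared moduli differ by `(|z|² - 1)(|l|² - 1)`. -/
theorem norm_sub_le_norm_one_sub_conj_mul {z l : ℂ} (hz : 1 ≤ ‖z‖) (hl : 1 ≤ ‖l‖) :
    ‖z - l‖ ≤ ‖1 - conj z * l‖ := by
  rw [← sq_le_sq₀ (norm_nonneg _) (norm_nonneg _), Complex.sq_norm, Complex.sq_norm]
  have h1 : 1 ≤ Complex.normSq z := by rw [← Complex.sq_norm]; nlinarith
  have h2 : 1 ≤ Complex.normSq l := by rw [← Complex.sq_norm]; nlinarith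
  have h : Complex.normSq (1 - conj z * l) - Complex.normSq (z - l)
      = (Complex.normSq z - 1) * (Complex.normSq l - 1) := by
    simp only [Complex.normSq_apply, Complex.sub_re, Complex.sub_im, Complex.mul_re,
      Complex.mul_im, Complex.conj_re, Complex.conj_im, Complex.one_re, Complex.one_im]
    ring
  nlinarith [mul_nonneg (sub_nonneg.mpr h1) (sub_nonneg.mpr h2)]

theorem norm_aeval_reverse {a : ℝ[X]} (ha : a.Monic) {z : ℂ} (hz : z ≠ 0) :
    ‖aeval z a.reverse‖
      = ((a.map (algebraMap ℝ ℂ)).roots.map fun l => ‖1 - conj z * l‖).prod := by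
  have hc : conj z ≠ 0 := (_root_.map_ne_zero _).mpr hz
  have h1 : ‖aeval z a.reverse‖ = ‖aeval (conj z) a.reverse‖ := by
    rw [aeval_conj, RCLike.norm_conj]
  let _ := invertibleOfNonzero (inv_ne_zero hc)
  -- Gives `a*(w) = wⁿ a(1/w)` at `w = conj z`; the conjugate puts the factors in Blaschke form.
  have h2 := eval₂_reverse_mul_pow (algebraMap ℝ ℂ) (conj z)⁻¹ a
  have h3 : aeval (conj z) a.reverse = (conj z) ^ a.natDegree * aeval (conj z)⁻¹ a := by
    rw [aeval_def, aeval_def, ← h2, invOf_eq_inv, inv_inv, mul_left_comm, ← mul_pow, mul_inv_cancel₀ hc, one_pow, mul_one]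
  have hcard : a.natDegree = (a.map (algebraMap ℝ ℂ)).roots.card := by
    rw [← natDegree_map (algebraMap ℝ ℂ)]
    exact (IsAlgClosed.splits _).natDegree_eq_card_roots
  rw [h1, h3, aeval_eq_prod_roots ha, hcard, ← Multiset.prod_replicate, ← Multiset.map_const',
    ← Multiset.prod_map_mul, Multiset.norm_prod_map]
  congr 1
  refine Multiset.map_congr rfl fun l _ => ?_
  rw [mul_sub, mul_inv_cancel₀ hc]

theorem norm_aeval_le_norm_aeval_reverse {a : ℝ[X]} (ha : a.Monic)
    (hroots : ∀ l ∈ (a.map (algebraMap ℝ ℂ)).roots, 1 ≤ ‖l‖) {z : ℂ} (hz : 1 ≤ ‖z‖) :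
    ‖aeval z a‖ ≤ ‖aeval z a.reverse‖ := by
  have hz0 : z ≠ 0 := norm_pos_iff.mp (by linarith)
  rw [norm_aeval_reverse ha hz0, aeval_eq_prod_roots ha, Multiset.norm_prod_map]
  exact Multiset.prod_map_le_prod_map₀ _ _ (fun l _ => norm_nonneg _)
    fun l hl => norm_sub_le_norm_one_sub_conj_mul hz (hroots l hl)

theorem aeval_reverse_ne_zero {a : ℝ[X]} (ha : a.Monic)
    (hroots : ∀ l ∈ (a.map (algebraMap ℝ ℂ)).roots, 1 < ‖l‖) {z : ℂ} (hz : 1 ≤ ‖z‖) :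
    aeval z a.reverse ≠ 0 := by
  have hz0 : z ≠ 0 := norm_pos_iff.mp (by linarith)
  rw [← norm_ne_zero_iff, norm_aeval_reverse ha hz0]
  refine Multiset.prod_ne_zero fun h => ?_
  obtain ⟨l, hl, h⟩ := Multiset.mem_map.mp h
  have h1 : ‖conj z * l‖ = 1 := by
    rw [← sub_eq_zero.mp (norm_eq_zero.mp h), norm_one]
  rw [norm_mul, RCLike.norm_conj] at h1
  nlinarith [hroots l hl]

/-! ### Robust root placement. -/

/-- The squared moduli differ by `(m² - 1)(1 - m²|d|²)`. -/
theorem norm_one_add_mul_sq_lt {m : ℝ} {d : ℂ} (hm : 1 < |m|) (hd : ‖d‖ * |m| < 1) :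
    ‖1 + d * (m : ℂ) ^ 2‖ < ‖(m : ℂ) * (1 + d)‖ := by
  rw [← sq_lt_sq₀ (norm_nonneg _) (norm_nonneg _), Complex.sq_norm, Complex.sq_norm]
  have h1 : 0 < m ^ 2 - 1 := by nlinarith [sq_abs m]
  have h2 : 0 < 1 - m ^ 2 * Complex.normSq d := by
    rw [← Complex.sq_norm, ← sq_abs m]
    have : 0 ≤ ‖d‖ * |m| := by positivity
    nlinarith
  have h : Complex.normSq ((m : ℂ) * (1 + d)) - Complex.normSq (1 + d * (m : ℂ) ^ 2)
      = (m ^ 2 - 1) * (1 - m ^ 2 * Complex.normSq d) := by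
    rw [← Complex.ofReal_pow]
    simp only [Complex.normSq_apply, Complex.add_re, Complex.add_im, Complex.mul_re,
      Complex.mul_im, Complex.ofReal_re, Complex.ofReal_im, Complex.one_re, Complex.one_im]
    ring
  nlinarith [mul_pos h1 h2]

/-- Robust pole placement for a polynomial all of whose roots lie outside the closed disk. -/
theorem exists_robust_of_roots_outside {a : ℝ[X]} (ha : a.Monic)
    (hroots : ∀ l ∈ (a.map (algebraMap ℝ ℂ)).roots, 1 < ‖l‖) (hm : 1 < |a.coeff 0|) :
    ∃ q : ℝ[X], q.degree < a.degree ∧ ∀ d z : ℂ, ‖d‖ * |a.coeff 0| < 1 → 1 ≤ ‖z‖ →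
      aeval z a + (1 + d) * aeval z q ≠ 0 := by
  set m := a.coeff 0 with hmdef
  have hm1 : 1 - m ^ 2 ≠ 0 := by nlinarith [sq_abs m]
  refine ⟨C (-m / (1 - m ^ 2)) * (a.reverse - C m * a), ?_, ?_⟩
  · rw [degree_eq_natDegree ha.ne_zero, degree_lt_iff_coeff_zero]
    intro j hj
    rw [coeff_C_mul]
    rcases hj.eq_or_lt with rfl | hj
    -- The top coefficient of `a*` is `m`, so it cancels in `a* - m a`.
    · have h1 : a.coeff a.natDegree = 1 := ha
      simp [coeff_reverse, revAt_le, h1, hmdef]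
    · rw [coeff_sub, coeff_C_mul, coeff_eq_zero_of_natDegree_lt hj,
        coeff_eq_zero_of_natDegree_lt ((reverse_natDegree_le a).trans_lt hj)]
      simp
  · intro d z hd hz h0
    have hm1' : (1 - (m : ℂ) ^ 2) ≠ 0 := by exact_mod_cast hm1
    have key : aeval z a * (1 + d * (m : ℂ) ^ 2) = aeval z a.reverse * (m * (1 + d)) := by
      simp only [map_mul, map_sub, aeval_C, Complex.coe_algebraMap] at h0
      push_cast at h0
      field_simp at h0
      linear_combination h0
    have hne := norm_pos_iff.mpr (aeval_reverse_ne_zero ha hroots hz)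
    have hle := norm_aeval_le_norm_aeval_reverse ha (fun l hl => (hroots l hl).le) hz
    have hlt := norm_one_add_mul_sq_lt hm hd
    have := congrArg norm key
    rw [norm_mul, norm_mul] at this
    nlinarith [norm_nonneg (1 + d * (m : ℂ) ^ 2)]

/-- Robust pole placement for a polynomial without roots in the open disk. -/
theorem exists_robust {a : ℝ[X]} (ha : a.Monic) (hdeg : a.natDegree ≠ 0)
    (hroots : ∀ l ∈ (a.map (algebraMap ℝ ℂ)).roots, 1 ≤ ‖l‖) {r : ℝ}
    (hra : r * |a.coeff 0| < 1) :
    ∃ q : ℝ[X], q.degree < a.degree ∧ ∀ d z : ℂ, ‖d‖ ≤ r → 1 ≤ ‖z‖ →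
      aeval z a + (1 + d) * aeval z q ≠ 0 := by
  -- The strict bound leaves room to multiply all roots by some `t > 1`, which multiplies `|a(0)|`
  -- by `t ^ deg a`.
  obtain ⟨t, ht1, ht⟩ : ∃ t : ℝ, 1 < t ∧ r * (|a.coeff 0| * t ^ a.natDegree) < 1 := by
    have hcont : Continuous fun t : ℝ => r * (|a.coeff 0| * t ^ a.natDegree) := by fun_prop
    have hev := (hcont.tendsto 1).eventually_lt_const
      (show r * (|a.coeff 0| * 1 ^ a.natDegree) < 1 by simpa using hra)
    have hev' : ∀ᶠ t in nhdsWithin (1 : ℝ) (Set.Ioi 1),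
        r * (|a.coeff 0| * t ^ a.natDegree) < 1 := hev.filter_mono nhdsWithin_le_nhds
    obtain ⟨t, h, h'⟩ := (hev'.and self_mem_nhdsWithin).exists
    exact ⟨t, h', h⟩
  have ht0 : (0 : ℝ) < t := by linarith
  have hb : (a.scaleRoots t).Monic := (monic_scaleRoots_iff t).mpr ha
  have hmap : (a.scaleRoots t).map (algebraMap ℝ ℂ)
      = (a.map (algebraMap ℝ ℂ)).scaleRoots (t : ℂ) :=
    map_scaleRoots a t _ (by simp [ha.leadingCoeff])
  have hbroots : ∀ l ∈ ((a.scaleRoots t).map (algebraMap ℝ ℂ)).roots, 1 < ‖l‖ := by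
    intro l hl
    rw [hmap, roots_scaleRoots _ (isUnit_iff_ne_zero.mpr (by exact_mod_cast ht0.ne'))] at hl
    obtain ⟨l', hl', rfl⟩ := Multiset.mem_map.mp hl
    have := hroots l' hl'
    simp only [norm_mul, Complex.norm_real, Real.norm_eq_abs, abs_of_pos ht0]
    nlinarith
  have hcoeff : |(a.scaleRoots t).coeff 0| = |a.coeff 0| * t ^ a.natDegree := by
    rw [coeff_scaleRoots, abs_mul, abs_pow, abs_of_pos ht0, Nat.sub_zero]
  have hone : 1 ≤ |a.coeff 0| := by
    rw [abs_coeff_zero_eq_prod_norm_roots ha]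
    refine Multiset.one_le_prod fun x hx => ?_
    obtain ⟨l, hl, rfl⟩ := Multiset.mem_map.mp hx
    exact hroots l hl
  have hpow : 1 < t ^ a.natDegree := one_lt_pow₀ ht1 hdeg
  obtain ⟨q, hq, hrob⟩ := exists_robust_of_roots_outside hb hbroots (by rw [hcoeff]; nlinarith)
  -- Undoes the scaling: `a(z) = t⁻ⁿ b(tz)` for the scaled polynomial `b`, and `|tz| ≥ 1` whenever
  -- `|z| ≥ 1`.
  refine ⟨C ((t ^ a.natDegree)⁻¹) * q.comp (C t * X), ?_, ?_⟩
  · rw [degree_scaleRoots, degree_eq_natDegree ha.ne_zero, degree_lt_iff_coeff_zero] at hq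
    rw [degree_eq_natDegree ha.ne_zero, degree_lt_iff_coeff_zero]
    intro j hj
    rw [coeff_C_mul, comp_C_mul_X_coeff, hq j hj, zero_mul, mul_zero]
  · intro d z hd hz h0
    refine hrob d (t * z) ?_ ?_ ?_
    · rw [hcoeff]
      refine lt_of_le_of_lt ?_ ht
      gcongr
    · rw [norm_mul, Complex.norm_real, Real.norm_eq_abs, abs_of_pos ht0]
      nlinarith
    · have h1 : aeval ((t : ℂ) * z) (a.scaleRoots t) = (t : ℂ) ^ a.natDegree * aeval z a :=
        scaleRoots_eval₂_mul (algebraMap ℝ ℂ) z t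
      have h2 : aeval z (q.comp (C t * X)) = aeval ((t : ℂ) * z) q := by
        simp [aeval_comp]
      have h3 : (t : ℂ) ^ a.natDegree ≠ 0 := pow_ne_zero _ (by exact_mod_cast ht0.ne')
      rw [map_mul, h2, aeval_C, Complex.coe_algebraMap] at h0
      push_cast at h0
      rw [h1]
      field_simp at h0
      linear_combination h0

end Polynomial

/-! ### From polynomials back to the agents. -/

namespace MultiAgent

open Polynomial Matrix

theorem isSchurStable_iff {k : ℕ} (M : Matrix (Fin k) (Fin k) ℂ) :
    IsSchurStable M ↔ ∀ z : ℂ, 1 ≤ ‖z‖ → M.charpoly.eval z ≠ 0 := by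
  simp only [IsSchurStable, Matrix.mem_spectrum_iff_isRoot_charpoly, IsRoot.def]
  exact forall_congr' fun z => by rw [← not_lt, not_imp_not]

theorem charpoly_toComplex {k : ℕ} (M : Matrix (Fin k) (Fin k) ℝ) :
    (toComplex M).charpoly = M.charpoly.map (algebraMap ℝ ℂ) :=
  M.charpoly_map (algebraMap ℝ ℂ)

theorem eval_charpoly_feedback {n : ℕ} (A : Matrix (Fin n) (Fin n) ℝ) (b k : Fin n → ℝ)
    (c z : ℂ) :
    (toComplex A - c • toComplex (vecMulVec b k)).charpoly.eval z
      = aeval z A.charpoly + c * aeval z (feedbackPoly A b k) := by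
  have h : toComplex A - c • toComplex (vecMulVec b k)
      = toComplex A - vecMulVec (algebraMap ℝ ℂ ∘ b) (c • (algebraMap ℝ ℂ ∘ k)) := by
    ext i j
    simp [toComplex, vecMulVec_apply]
  have hf : (feedbackPoly A b k).map (algebraMap ℝ ℂ)
      = feedbackPoly (toComplex A) (algebraMap ℝ ℂ ∘ b) (algebraMap ℝ ℂ ∘ k) :=
    feedbackPoly_map (algebraMap ℝ ℂ) A b k
  rw [h, charpoly_sub_vecMulVec, feedbackPoly_smul, ← hf, charpoly_toComplex]
  simp [aeval_def, eval_map]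

/-- Robust stabilization by a single input: all loop gains in a closed disk around `1` of radius
less than the inverse of the product of the unstable eigenvalues are tolerated. -/
theorem exists_robust_feedback {n : ℕ} (A : Matrix (Fin n) (Fin n) ℝ)
    (B : Matrix (Fin n) (Fin 1) ℝ) (hstab : IsStabilizable A B)
    (hu : unstableEigenvalues A ≠ 0) {r : ℝ}
    (hprod : r * ((unstableEigenvalues A).map fun z => ‖z‖).prod < 1) :
    ∃ K : Matrix (Fin 1) (Fin n) ℝ, ∀ c : ℂ, ‖1 - c‖ ≤ r →
      IsSchurStable (toComplex A - c • toComplex (B * K)) := by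
  have hBK : ∀ K : Matrix (Fin 1) (Fin n) ℝ, B * K = vecMulVec (fun i => B i 0) (K 0) := by
    intro K
    ext i j
    simp [mul_apply, vecMulVec_apply]
  obtain ⟨s, a, hsa, hs, ha, hsroots, haroots⟩ :=
    exists_real_factorization A.charpoly_monic (fun z : ℂ => 1 ≤ ‖z‖) fun z => by
      rw [RCLike.norm_conj]
  rw [← charpoly_toComplex] at hsroots haroots
  change _ = unstableEigenvalues A at haroots
  have mem_roots' : ∀ {f : ℝ[X]}, f.Monic → ∀ z : ℂ, aeval z f = 0 →
      z ∈ (f.map (algebraMap ℝ ℂ)).roots := by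
    intro f hf z hz
    rw [mem_roots (hf.map _).ne_zero, IsRoot.def, eval_map, ← aeval_def, hz]
  have hs0 : ∀ z : ℂ, 1 ≤ ‖z‖ → aeval z s ≠ 0 := by
    intro z hz h
    have := mem_roots' hs z h
    rw [hsroots, Multiset.mem_filter] at this
    exact this.2 hz
  have ha1 : ∀ l ∈ (a.map (algebraMap ℝ ℂ)).roots, 1 ≤ ‖l‖ := by
    intro l hl
    rw [haroots, unstableEigenvalues, Multiset.mem_filter] at hl
    exact hl.2
  have hdeg : a.natDegree ≠ 0 := by
    intro h
    rw [ha.natDegree_eq_zero.mp h] at haroots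
    exact hu (by simpa using haroots.symm)
  obtain ⟨q, hq, hrob⟩ := exists_robust ha hdeg ha1
    (by rwa [abs_coeff_zero_eq_prod_norm_roots ha, haroots])
  obtain ⟨K₀, hK₀⟩ := hstab
  -- No common zero: the stabilized polynomial has none in `|z| ≥ 1`, and `a` has none in `|z| < 1`.
  -- The sign of `K₀` turns `A + BK₀` into the form `A - bk`.
  have hcop : IsCoprime a (A.charpoly + feedbackPoly A (fun i => B i 0) (-K₀ 0)) := by
    rw [isCoprime_iff_aeval_ne_zero_of_isAlgClosed ℝ ℂ]
    intro z
    by_cases hz : 1 ≤ ‖z‖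
    · right
      have h : A + B * K₀ = A - vecMulVec (fun i => B i 0) (-K₀ 0) := by
        rw [hBK, vecMulVec_neg, sub_neg_eq_add]
      have := (isSchurStable_iff _).mp hK₀ z hz
      rwa [charpoly_toComplex, h, charpoly_sub_vecMulVec, eval_map, ← aeval_def] at this
    · exact Or.inl fun h => hz (ha1 z (mem_roots' ha z h))
  obtain ⟨k, hk⟩ := exists_feedbackPoly_eq A _ _ hsa hcop hq
  refine ⟨of fun _ => k, fun c hc => (isSchurStable_iff _).mpr fun z hz => ?_⟩
  have h := hrob (c - 1) z (by rwa [norm_sub_rev]) hz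
  have he : aeval z A.charpoly + c * aeval z (feedbackPoly A (fun i => B i 0) k)
      = aeval z s * (aeval z a + (1 + (c - 1)) * aeval z q) := by
    rw [hk, hsa, map_mul, map_mul]
    ring
  rw [hBK]
  change (toComplex A - c • toComplex (vecMulVec _ k)).charpoly.eval z ≠ 0
  rw [eval_charpoly_feedback, he]
  exact mul_ne_zero (hs0 z hz) h

theorem coe_unstableProduct {n : ℕ} {A : Matrix (Fin n) (Fin n) ℝ}
    (hu : unstableEigenvalues A ≠ 0) :
    unstableProduct A = ENNReal.ofReal ((unstableEigenvalues A).map fun z => ‖z‖).prod := by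
  rw [unstableProduct, if_neg hu]
  induction unstableEigenvalues A using Multiset.induction_on with
  | empty => simp
  | cons z s ih =>
    rw [Multiset.map_cons, Multiset.map_cons, Multiset.prod_cons, Multiset.prod_cons, ih,
      ENNReal.ofReal_mul (norm_nonneg z), ofReal_norm]

/-- The bound on the unstable eigenvalues is attained by a scaling `ω` of the Laplacian. -/
theorem exists_scaling {n N : ℕ} {A : Matrix (Fin n) (Fin n) ℝ} {G : WeightedDigraph N}
    (hu : unstableEigenvalues A ≠ 0) (hprod : unstableProduct A < 1 / G.infMax) :
    ∃ ω r : ℝ, r * ((unstableEigenvalues A).map fun z => ‖z‖).prod < 1 ∧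
      ∀ μ ∈ G.tailEigenvalues, ‖1 - (ω : ℂ) * μ‖ ≤ r := by
  set p := ((unstableEigenvalues A).map fun z => ‖z‖).prod with hp
  have hp1 : 1 ≤ p := by
    refine Multiset.one_le_prod fun x hx => ?_
    obtain ⟨z, hz, rfl⟩ := Multiset.mem_map.mp hx
    exact (Multiset.mem_filter.mp hz).2
  -- Inverting gives `infMax < 1/p`; strictness yields a suitable `ω` even if the infimum is not
  -- attained.
  rw [coe_unstableProduct hu, one_div, ENNReal.lt_inv_iff_lt_inv, WeightedDigraph.infMax,
    iInf_lt_iff] at hprod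
  obtain ⟨ω, hω⟩ := hprod
  set S := ⨆ μ ∈ G.tailEigenvalues, ‖1 - (ω : ℂ) * μ‖ₑ
  have hS : S ≠ ∞ := (hω.trans_le le_top).ne
  refine ⟨ω, S.toReal, ?_, fun μ hμ => ?_⟩
  · rw [← ENNReal.ofReal_inv_of_pos (by linarith), ← ENNReal.ofReal_toReal hS,
      ENNReal.ofReal_lt_ofReal_iff (by positivity)] at hω
    rwa [← lt_div_iff₀ (by linarith), one_div]
  · rw [← toReal_enorm]
    exact ENNReal.toReal_mono hS (le_iSup₂ (f := fun μ _ => ‖1 - (ω : ℂ) * μ‖ₑ) μ hμ)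

end MultiAgent

/-- In `ℝ≥0∞` one has `1 / 0 = ∞`, so that the bound is void if the infimum is zero. -/
theorem theorem2 {n N : ℕ} (A : Matrix (Fin n) (Fin n) ℝ) (B : Matrix (Fin n) (Fin 1) ℝ)
    (G : MultiAgent.WeightedDigraph N)
    (hstab : MultiAgent.IsStabilizable A B)
    (hprod : MultiAgent.unstableProduct A < 1 / G.infMax) :
    MultiAgent.SimultaneouslyStabilizable A B G := by
  by_cases hu : MultiAgent.unstableEigenvalues A = 0
  -- `A` is already stable, so the zero gain works.
  · refine ⟨0, fun μ _ z hz => ?_⟩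
    have h0 : MultiAgent.toComplex A - μ • MultiAgent.toComplex (B * (0 : Matrix (Fin 1) (Fin n) ℝ))
        = MultiAgent.toComplex A := by
      ext i j
      simp [MultiAgent.toComplex]
    rw [h0, Matrix.mem_spectrum_iff_isRoot_charpoly,
      ← Polynomial.mem_roots (Matrix.charpoly_monic _).ne_zero] at hz
    by_contra hlt
    exact Multiset.eq_zero_iff_forall_notMem.mp hu z
      (Multiset.mem_filter.mpr ⟨hz, not_lt.mp hlt⟩)
  · obtain ⟨ω, r, hrp, hω⟩ := MultiAgent.exists_scaling hu hprod
    obtain ⟨K, hK⟩ := MultiAgent.exists_robust_feedback A B hstab hu hrp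
    refine ⟨ω • K, fun μ hμ => ?_⟩
    have h := hK (ω * μ) (hω μ hμ)
    have he : MultiAgent.toComplex A - μ • MultiAgent.toComplex (B * (ω • K))
        = MultiAgent.toComplex A - ((ω : ℂ) * μ) • MultiAgent.toComplex (B * K) := by
      ext i j
      simp only [MultiAgent.toComplex, Matrix.mul_smul, Matrix.sub_apply, Matrix.smul_apply,
        Matrix.map_apply, smul_eq_mul, Complex.ofReal_mul]
      ring
    rwa [he]
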